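/- **Setting.** A *superprojective system* is a sequence $f=\{f_n\}_{n\ge1}$ of functions $f_n\in L^2(\mathbb R^n)$ with $f_n\ge 0$ a.e. and $$\int_{\mathbb R}|f_{n+1}(x,x')|^2\,dx'\le |f_n(x)|^2\quad\text{for a.e. }x\in\mathbb R^n\qquad(n=1,2,\dots).$$ Let $\mathcal L^2(\mathbb R^\infty)$ (the *square roots of measures*) be the complex linear hull, under termwise operations, of the set of superprojective systems inside the space of all sequences $\{f_n\}$, $f_n\in L^2(\mathbb R^n;\mathbb C)$. For $f,g\in\mathcal L^2(\mathbb R^\infty)$ the limit $\langle f,g\rangle=\lim_{n\to\infty}\int_{\mathbb R^n}f_n(x)\overline{g_n(x)}\,dx$ exists; put $\|f\|=\sqrt{\langle f,f\rangle}$. For $h\in\mathbb R^\infty$ let $(\tau_hf)_n(x)=f_n(x_1-h_1,\dots,x_n-h_n)$. Let $\mathbb R_0^\infty$ be the space of finitely supported real sequences with the topology of the countable direct sum of real lines, i.e. the locally convex topology generated by the seminorms $y\mapsto\sum_n|a_ny_n|$, $a\in\mathbb R^\infty$. We call $f$ *$\mathbb R_0^\infty$-shift continuous* if $\|\tau_{h}f-f\|\to0$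 as $h\to0$ in $\mathbb R_0^\infty$. Let $\hat f_n$ be the $L^2$-Fourier transform of $f_n$, $$\hat f_n(\xi)=\underset{L\to\infty}{\mathrm{l.i.m.}}\int_{|x|\le L}e^{2\pi\sqrt{-1}\langle x,\xi\rangle_n}f_n(x)\,dx,\qquad \langle x,\xi\rangle_n=\sum_{j=1}^n x_j\xi_j .$$ **Proposition 3.5.** Let $f=\{f_n\}\in\mathcal L^2(\mathbb R^\infty)$ be $\mathbb R_0^\infty$-shift continuous. Then there is a unique bounded positive Borel measure $\mu$ on $\mathbb R^\infty$ such that $$\lim_{n\to\infty}\int_{\mathbb R^n}e^{2\pi\sqrt{-1}\langle x,\xi\rangle_n}|\hat f_n(\xi)|^2\,d\xi=\int_{\mathbb R^\infty}e^{2\pi\sqrt{-1}\langle x,y\rangle}\,\mu(dy)\qquad\text{for all }x\in\mathbb R_0^\infty,$$ where $\langle x,y\rangle=\sum_{n\ge 1} x_ny_n$ and $\langle x,\xi\rangle_n=\sum_{j=1}^n x_j\xi_j$. (This $\mu$ is by definition the square $|\hat f|^2$ of the Fourier transform $\hat f=\{\hat f_n\}$.) -/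

import Mathlib

open MeasureTheory Filter Topology
open scoped FourierTransform ComplexConjugate

noncomputable section

namespace SqrtMeasure

/-- Sequences `(f_1, f_2, …)` with `f_k ∈ L²(ℝ^k; ℂ)`. Indices start at `0` here: the entry with
index `n` is the function on `ℝ^(n+1)`. Addition and scalar multiplication are termwise. -/
abbrev L2Seq : Type :=
  (n : ℕ) → Lp ℂ 2 (volume : Measure (EuclideanSpace ℝ (Fin (n + 1))))

/-- The point `(x, t)` of `ℝ^(n+2)`, for `x ∈ ℝ^(n+1)` and `t ∈ ℝ`. -/
def append {n : ℕ} (x : EuclideanSpace ℝ (Fin (n + 1))) (t : ℝ) :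
    EuclideanSpace ℝ (Fin (n + 2)) :=
  WithLp.toLp 2 (Fin.snoc (α := fun _ => ℝ) (fun i => x i) t)

/-- Superprojective systems of `L²`-functions: every `f_n` is nonnegative (almost everywhere) and
`∫ |f_{n+1}(x, t)|² dt ≤ |f_n(x)|²` for almost every `x`. -/
structure IsSuperprojective (f : L2Seq) : Prop where
  nonneg : ∀ n, ∀ᵐ x, 0 ≤ (f n x).re ∧ (f n x).im = 0
  compat : ∀ n, ∀ᵐ x, ∫⁻ t : ℝ, ‖f (n + 1) (append x t)‖ₑ ^ 2 ≤ ‖f n x‖ₑ ^ 2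

/-- The space `ℒ²(ℝ^∞)` of square roots of measures: the complex linear hull of the set of
superprojective systems. -/
def SqrtMeasures : Submodule ℂ L2Seq :=
  Submodule.span ℂ {f | IsSuperprojective f}

/-- The sesquilinear form `⟨f, g⟩ = (f · ḡ)(ℝ^∞) = lim_n ∫_{ℝ^n} f_n(x) ḡ_n(x) dx`. -/
def form (f g : L2Seq) : ℂ :=
  limUnder atTop fun n => ∫ x, f n x * conj (g n x)

theorem measurePreserving_append (n : ℕ) :
    MeasurePreserving (fun p : EuclideanSpace ℝ (Fin (n + 1)) × ℝ => append p.1 p.2)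
      (volume.prod volume) volume := by
  have h1 := (volume_preserving_piFinSuccAbove (fun _ : Fin (n + 2) => ℝ) (Fin.last _)).symm
  have h2 := (PiLp.volume_preserving_toLp (Fin (n + 2))).comp h1
  have h3 : MeasurePreserving (Prod.map (id : ℝ → ℝ) (WithLp.ofLp (p := 2)))
      ((volume : Measure ℝ).prod (volume : Measure (EuclideanSpace ℝ (Fin (n + 1)))))
      ((volume : Measure ℝ).prod (volume : Measure (Fin (n + 1) → ℝ))) :=
    (MeasurePreserving.id _).prod (PiLp.volume_preserving_ofLp (Fin (n + 1)))
  have h4 := h2.comp h3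
  have h5 := h4.comp (Measure.measurePreserving_swap (μ := (volume : Measure (EuclideanSpace ℝ (Fin (n + 1))))) (ν := (volume : Measure ℝ)))
  have e : (fun p : EuclideanSpace ℝ (Fin (n + 1)) × ℝ => append p.1 p.2) =
      ((WithLp.toLp 2 ∘ (MeasurableEquiv.piFinSuccAbove (fun _ : Fin (n + 2) => ℝ)
        (Fin.last _)).symm) ∘ Prod.map id WithLp.ofLp) ∘ Prod.swap := by
    funext p
    simp [append, MeasurableEquiv.piFinSuccAbove, Fin.insertNth_last', Fin.insertNthEquiv]
  rw [e]
  exact h5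

theorem lintegral_succ_le {f g : L2Seq} (hf : IsSuperprojective f) (hg : IsSuperprojective g)
    (n : ℕ) : ∫⁻ x, ‖f (n + 1) x‖ₑ * ‖g (n + 1) x‖ₑ ≤ ∫⁻ x, ‖f n x‖ₑ * ‖g n x‖ₑ := by
  have mf := (Lp.stronglyMeasurable (f (n + 1))).measurable.enorm
  have mg := (Lp.stronglyMeasurable (g (n + 1))).measurable.enorm
  have ma := (measurePreserving_append n).measurable
  have hc := (measurePreserving_append n).lintegral_comp (mf.mul mg)
  simp only [Pi.mul_apply] at hc
  rw [← hc]
  refine (lintegral_prod _ ((mf.mul mg).comp ma).aemeasurable).trans_le (lintegral_mono_ae ?_)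
  filter_upwards [hf.compat n, hg.compat n] with x hx hy
  have mx : Measurable fun t : ℝ => append x t := ma.comp measurable_prodMk_left
  refine (ENNReal.lintegral_mul_le_Lp_mul_Lq volume Real.HolderConjugate.two_two
    (mf.comp mx).aemeasurable (mg.comp mx).aemeasurable).trans ?_
  have key : ∀ a b : ENNReal, a ≤ b ^ 2 → a ^ (1 / (2 : ℝ)) ≤ b := fun a b h => by
    rw [one_div, ENNReal.rpow_inv_le_iff (by norm_num)]
    exact_mod_cast h
  refine mul_le_mul' (key _ _ ?_) (key _ _ ?_)
  · exact_mod_cast hx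
  · exact_mod_cast hy

theorem integral_eq {f g : L2Seq} (hf : IsSuperprojective f) (hg : IsSuperprojective g) (n : ℕ) :
    ∫ x, f n x * conj (g n x) = (((∫⁻ x, ‖f n x‖ₑ * ‖g n x‖ₑ).toReal : ℝ) : ℂ) := by
  have mf := (Lp.stronglyMeasurable (f n)).measurable
  have mg := (Lp.stronglyMeasurable (g n)).measurable
  have : ∫ x, f n x * conj (g n x) = ∫ x, ((‖f n x‖ * ‖g n x‖ : ℝ) : ℂ) := by
    refine integral_congr_ae ?_
    filter_upwards [hf.nonneg n, hg.nonneg n] with x hx hy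
    have e : ∀ z : ℂ, 0 ≤ z.re ∧ z.im = 0 → z = (‖z‖ : ℂ) := fun z hz => by
      have : z = (z.re : ℂ) := Complex.ext rfl (by simp [hz.2])
      rw [this, Complex.norm_real, Real.norm_of_nonneg hz.1]
    rw [e _ hx, e _ hy]
    simp
  rw [this, integral_complex_ofReal, integral_eq_lintegral_of_nonneg_ae
    (Eventually.of_forall fun x => by positivity) (by fun_prop)]
  congr 3
  funext x
  rw [ENNReal.ofReal_mul (norm_nonneg _), ofReal_norm, ofReal_norm]

theorem integrable_mul_conj (f g : L2Seq) (n : ℕ) :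
    Integrable (fun x => f n x * conj (g n x)) := by
  have := L2.integrable_inner (𝕜 := ℂ) (g n) (f n)
  simpa [RCLike.inner_apply, mul_comm] using this

/-- On `ℒ²(ℝ^∞)` the limit that defines `⟨f, g⟩` exists. -/
theorem tendsto_form {f g : L2Seq} (hf : f ∈ SqrtMeasures) (hg : g ∈ SqrtMeasures) :
    Tendsto (fun n => ∫ x, f n x * conj (g n x)) atTop (𝓝 (form f g)) := by
  refine tendsto_nhds_limUnder ?_
  have base : ∀ f g : L2Seq, IsSuperprojective f → IsSuperprojective g →
      ∃ L : ℂ, Tendsto (fun n => ∫ x, f n x * conj (g n x)) atTop (𝓝 L) := by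
    intro f g hf hg
    simp_rw [integral_eq hf hg]
    have hfin : ∀ n, ∫⁻ x, ‖f n x‖ₑ * ‖g n x‖ₑ ≠ ⊤ := fun n => by
      have := (integrable_mul_conj f g n).2
      simp only [HasFiniteIntegral, enorm_mul] at this
      simpa [enorm_eq_nnnorm] using this.ne
    have hanti : Antitone fun n => (∫⁻ x, ‖f n x‖ₑ * ‖g n x‖ₑ).toReal :=
      antitone_nat_of_succ_le fun n => ENNReal.toReal_mono (hfin n) (lintegral_succ_le hf hg n)
    exact ⟨_, (Complex.continuous_ofReal.tendsto _).comp (tendsto_atTop_ciInf hanti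
      ⟨0, by rintro _ ⟨n, rfl⟩; exact ENNReal.toReal_nonneg⟩)⟩
  induction hf, hg using Submodule.span_induction₂ with
  | mem_mem f g hf hg => exact base f g hf hg
  | zero_left g hg =>
    refine ⟨0, tendsto_const_nhds.congr fun n => ?_⟩
    rw [integral_eq_zero_of_ae]
    exact Eventually.of_forall fun x => by simp
  | zero_right f hf =>
    refine ⟨0, tendsto_const_nhds.congr fun n => ?_⟩
    rw [integral_eq_zero_of_ae]
    exact Eventually.of_forall fun x => by simp
  | add_left f f' g _ _ _ h h' =>
    obtain ⟨L, h⟩ := h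
    obtain ⟨L', h'⟩ := h'
    refine ⟨L + L', (h.add h').congr fun n => ?_⟩
    rw [← integral_add (integrable_mul_conj _ _ n) (integrable_mul_conj _ _ n)]
    refine integral_congr_ae ?_
    filter_upwards [Lp.coeFn_add (f n) (f' n)] with x hx
    simp only [Pi.add_apply] at hx ⊢
    rw [hx, add_mul]
  | add_right f g g' _ _ _ h h' =>
    obtain ⟨L, h⟩ := h
    obtain ⟨L', h'⟩ := h'
    refine ⟨L + L', (h.add h').congr fun n => ?_⟩
    rw [← integral_add (integrable_mul_conj _ _ n) (integrable_mul_conj _ _ n)]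
    refine integral_congr_ae ?_
    filter_upwards [Lp.coeFn_add (g n) (g' n)] with x hx
    simp only [Pi.add_apply] at hx ⊢
    rw [hx, map_add, mul_add]
  | smul_left c f g _ _ h =>
    obtain ⟨L, h⟩ := h
    refine ⟨c * L, (h.const_mul c).congr fun n => ?_⟩
    rw [← integral_const_mul]
    refine integral_congr_ae ?_
    filter_upwards [Lp.coeFn_smul c (f n)] with x hx
    simp [hx, mul_assoc]
  | smul_right c f g _ _ h =>
    obtain ⟨L, h⟩ := h
    refine ⟨conj c * L, (h.const_mul (conj c)).congr fun n => ?_⟩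
    rw [← integral_const_mul]
    refine integral_congr_ae ?_
    filter_upwards [Lp.coeFn_smul c (g n)] with x hx
    simp [hx, mul_left_comm]

/-- The seminorm `‖f‖ = √⟨f, f⟩`. -/
def seminorm (f : L2Seq) : ℝ := √(form f f).re

/-- The projection `ℝ^∞ → ℝ^(n+1)` onto the first `n + 1` coordinates. -/
def proj (n : ℕ) (h : ℕ → ℝ) : EuclideanSpace ℝ (Fin (n + 1)) :=
  WithLp.toLp 2 fun i => h i

/-- The translation `(τ_h f)_n (x) = f_n (x - p_n h)`, for `h ∈ ℝ^∞`. -/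
def translate (h : ℕ → ℝ) (f : L2Seq) : L2Seq := fun n =>
  Lp.compMeasurePreserving (fun x => x - proj n h)
    (measurePreserving_sub_right volume (proj n h)) (f n)

/-- The seminorm `y ↦ ∑ |a_n y_n|` on the space `ℝ_0^∞` (here `ℕ →₀ ℝ`) of finitely supported
real sequences, for an arbitrary real sequence `a`. -/
def weightedSeminorm : SeminormFamily ℝ (ℕ →₀ ℝ) (ℕ → ℝ) := fun a =>
  Seminorm.of (fun y => y.sum fun n t => |a n * t|)
    (fun y z => by
      classical
      rw [Finsupp.sum_of_support_subset (y + z) Finsupp.support_add _ (by simp),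
        Finsupp.sum_of_support_subset y Finset.subset_union_left _ (by simp),
        Finsupp.sum_of_support_subset z Finset.subset_union_right _ (by simp),
        ← Finset.sum_add_distrib]
      refine Finset.sum_le_sum fun i _ => ?_
      rw [Finsupp.add_apply, mul_add]
      exact abs_add_le _ _)
    (fun c y => by
      rw [Finsupp.sum_of_support_subset (c • y) Finsupp.support_smul _ (by simp),
        Finsupp.sum, Finset.mul_sum]
      refine Finset.sum_congr rfl fun i _ => ?_
      rw [Finsupp.smul_apply, smul_eq_mul, Real.norm_eq_abs, ← abs_mul]
      congr 1
      ring)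

/-- The topology of `ℝ_0^∞` as the countable direct sum of real lines (the locally convex direct
sum): it is generated by all the seminorms `y ↦ ∑ |a_n y_n|`, `a ∈ ℝ^∞`. -/
abbrev directSumTopology : TopologicalSpace (ℕ →₀ ℝ) :=
  weightedSeminorm.moduleFilterBasis.topology

/-- `f` is `ℝ_0^∞`-shift continuous: `‖τ_h f - f‖ → 0` as `h → 0` in `ℝ_0^∞`. -/
def IsShiftContinuous (f : L2Seq) : Prop :=
  Tendsto (fun h : ℕ →₀ ℝ => seminorm (translate h f - f)) (@nhds _ directSumTopology 0) (𝓝 0)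

/-- The Fourier transform `f̂_n(ξ) = l.i.m. ∫ e^{2πi⟨x, ξ⟩} f_n(x) dx`, taken termwise on `L²`.
In Mathlib's sign convention (`𝓕` has the kernel `e^{-2πi⟨x, ξ⟩}`, `𝓕⁻` the kernel
`e^{2πi⟨x, ξ⟩}`) this is the `L²` operator `𝓕⁻`. -/
def fourier (f : L2Seq) : L2Seq := fun n => 𝓕⁻ (f n)

end SqrtMeasure

end

/-! Plancherel turns the integral of `e^{2πi⟨x, ξ⟩} |f̂_n(ξ)|²` into `⟨τ_x f_n, f_n⟩`. Translation
preserves `SqrtMeasures`, so by `tendsto_form` these numbers converge to `φ x = form (translate x f)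
f`. Thus `φ` is a pointwise limit of characteristic functions of finite measures on `ℝ^∞`, namely
`|f̂_n|² dξ` extended by zeros. By Cauchy–Schwarz, `|φ x - φ 0| ≤ ‖τ_x f - f‖ ‖f‖`, so shift
continuity makes `φ` continuous at `0` along each axis. That gives tight marginals, hence tightness
on `ℝ^∞`, where products of compact sets are compact. By Prokhorov a weak cluster point exists, and
its characteristic function is `φ` (`exists_finiteMeasure_of_tendsto_character`). Uniqueness is
injectivity of the characteristic function (`ext_of_integral_character`). -/

noncomputable section

namespace SqrtMeasure

/-! ### Plancherel's theorem for translates -/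

section Plancherel

variable {E : Type*} [NormedAddCommGroup E] [InnerProductSpace ℝ E]

/-- The modulation `ξ ↦ e^{2πi⟨h, ξ⟩}`. -/
def modulation (h ξ : E) : ℂ :=
  Complex.exp (2 * Real.pi * Complex.I * (inner ℝ h ξ : ℝ))

theorem norm_modulation (h ξ : E) : ‖modulation h ξ‖ = 1 := by
  rw [modulation, show (2 * Real.pi * Complex.I * (inner ℝ h ξ : ℝ) : ℂ) =
    ((2 * Real.pi * inner ℝ h ξ : ℝ) : ℂ) * Complex.I by push_cast; ring]
  exact Complex.norm_exp_ofReal_mul_I _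

theorem continuous_modulation (h : E) : Continuous (modulation h) := by
  unfold modulation
  fun_prop

variable [FiniteDimensional ℝ E] [MeasurableSpace E] [BorelSpace E]

theorem memLp_top_modulation (h : E) : MemLp (modulation h) ⊤ (volume : Measure E) :=
  memLp_top_of_bound (continuous_modulation h).aestronglyMeasurable 1
    (Eventually.of_forall fun ξ => (norm_modulation h ξ).le)

/-- The inverse Fourier transform turns translations into modulations. -/
theorem fourierInv_comp_sub_right (f : E → ℂ) (h ξ : E) :
    𝓕⁻ (fun x => f (x - h)) ξ = modulation h ξ * 𝓕⁻ f ξ := by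
  rw [Real.fourierInv_eq', Real.fourierInv_eq', ← integral_const_mul,
    ← integral_add_right_eq_self _ h]
  refine integral_congr_ae (Eventually.of_forall fun x => ?_)
  simp only [add_sub_cancel_right, smul_eq_mul, modulation, inner_add_left, ← mul_assoc,
    ← Complex.exp_add]
  congr 2
  push_cast
  ring

/-- The `L²` inverse Fourier transform turns translations into modulations. -/
theorem fourierInv_compMeasurePreserving_sub (F : Lp ℂ 2 (volume : Measure E)) (h : E) :
    𝓕⁻ (Lp.compMeasurePreserving (fun x => x - h) (measurePreserving_sub_right volume h) F) =
      ((memLp_top_modulation h).toLp _ • 𝓕⁻ F : Lp ℂ 2 (volume : Measure E)) := by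
  -- Both sides are continuous in `F`, so Schwartz functions suffice; there the transform is an
  -- honest integral.
  refine DenseRange.induction_on
    (p := fun F : Lp ℂ 2 (volume : Measure E) => 𝓕⁻ (Lp.compMeasurePreserving (fun x => x - h)
      (measurePreserving_sub_right volume h) F) =
      ((memLp_top_modulation h).toLp _ • 𝓕⁻ F : Lp ℂ 2 (volume : Measure E)))
    (SchwartzMap.denseRange_toLpCLM (p := 2) ENNReal.ofNat_ne_top) F ?_ fun f => ?_
  · refine isClosed_eq ?_ ?_
    · exact (Lp.fourierTransformₗᵢ E ℂ).symm.continuous.comp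
        (Lp.isometry_compMeasurePreserving _).continuous
    -- By Hölder, multiplication by an `L^∞` function is continuous on `L²`.
    · exact (((ContinuousLinearMap.lsmul ℂ ℂ).holderL volume ⊤ 2 2
        ((memLp_top_modulation h).toLp _)).continuous).comp
        (Lp.fourierTransformₗᵢ E ℂ).symm.continuous
  · have e : Lp.compMeasurePreserving (fun x => x - h) (measurePreserving_sub_right volume h)
        (SchwartzMap.toLpCLM ℝ ℂ 2 volume f) = (f.compSubConstCLM ℂ h).toLp 2 := by
      refine Lp.ext ?_
      filter_upwards [Lp.coeFn_compMeasurePreserving (SchwartzMap.toLpCLM ℝ ℂ 2 volume f)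
        (measurePreserving_sub_right volume h), (f.compSubConstCLM ℂ h).coeFn_toLp 2 volume,
        (measurePreserving_sub_right volume h).quasiMeasurePreserving.ae (f.coeFn_toLp 2 volume)]
        with x h1 h2 h3
      rw [h1, h2]
      exact h3
    rw [e, SchwartzMap.toLpCLM_apply, SchwartzMap.toLp_fourierInv_eq,
      SchwartzMap.toLp_fourierInv_eq]
    refine Lp.ext ?_
    filter_upwards [(𝓕⁻ (f.compSubConstCLM ℂ h)).coeFn_toLp 2 volume,
      (𝓕⁻ f).coeFn_toLp 2 volume, (memLp_top_modulation h).coeFn_toLp,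
      Lp.coeFn_lpSMul (r := 2) ((memLp_top_modulation h).toLp _) ((𝓕⁻ f).toLp 2 volume)]
      with ξ h1 h2 h3 h4
    rw [h1, h4, Pi.smul_apply', h2, h3, SchwartzMap.fourierInv_coe, SchwartzMap.fourierInv_coe]
    exact fourierInv_comp_sub_right f h ξ

theorem integral_modulation_mul_norm_sq_fourierInv (F : Lp ℂ 2 (volume : Measure E)) (h : E) :
    ∫ ξ, modulation h ξ * ((‖(𝓕⁻ F : Lp ℂ 2 (volume : Measure E)) ξ‖ ^ 2 : ℝ) : ℂ) =
      ∫ x, Lp.compMeasurePreserving (fun x => x - h)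
        (measurePreserving_sub_right volume h) F x * conj (F x) := by
  set G := Lp.compMeasurePreserving (fun x => x - h)
        (measurePreserving_sub_right volume h) F with hG
  have e := (Lp.fourierTransformₗᵢ E ℂ).symm.inner_map_map F G
  change inner ℂ (𝓕⁻ F) (𝓕⁻ G) = _ at e
  rw [L2.inner_def, L2.inner_def] at e
  simp only [RCLike.inner_apply] at e
  rw [← e, hG, fourierInv_compMeasurePreserving_sub]
  refine integral_congr_ae ?_
  filter_upwards [(memLp_top_modulation h).coeFn_toLp, Lp.coeFn_lpSMul (r := 2)
    ((memLp_top_modulation h).toLp _) (𝓕⁻ F : Lp ℂ 2 (volume : Measure E))] with ξ h1 h2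
  rw [h2, Pi.smul_apply', h1, smul_eq_mul, mul_assoc, Complex.mul_conj, Complex.normSq_eq_norm_sq]

end Plancherel

/-! ### Characteristic functions and Lévy continuity on `ℝ^∞` -/

section LevyContinuity

/-- The pairing `⟨x, y⟩ = ∑ x_k y_k` of `ℝ_0^∞` and `ℝ^∞`. -/
def pairing : (ℕ → ℝ) →ₗ[ℝ] (ℕ →₀ ℝ) →ₗ[ℝ] ℝ :=
  LinearMap.mk₂ ℝ (fun y x => x.sum fun k t => t * y k)
    (fun y y' x => by simp [mul_add, Finsupp.sum_add])
    (fun c y x => by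
      simp only [Pi.smul_apply, smul_eq_mul, Finsupp.sum, Finset.mul_sum]
      exact Finset.sum_congr rfl fun _ _ => by ring)
    (fun y x x' => Finsupp.sum_add_index' (by simp) (by intros; ring))
    (fun c y x => by
      rw [Finsupp.sum_smul_index (by simp), Finsupp.smul_sum]
      simp only [smul_eq_mul, mul_assoc])

theorem pairing_apply (y : ℕ → ℝ) (x : ℕ →₀ ℝ) : pairing y x = x.sum fun k t => t * y k := rfl

theorem continuous_pairing (x : ℕ →₀ ℝ) : Continuous fun y => pairing y x := by
  simp only [pairing_apply, Finsupp.sum]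
  fun_prop

/-- The bounded continuous function `y ↦ e^{2πi⟨x, y⟩}` on `ℝ^∞`. -/
def character (x : ℕ →₀ ℝ) : BoundedContinuousFunction (ℕ → ℝ) ℂ :=
  BoundedContinuousFunction.ofNormedAddCommGroup
    (fun y => Complex.exp (2 * Real.pi * Complex.I * ((pairing y x : ℝ) : ℂ)))
    (by have := continuous_pairing x; fun_prop) 1 fun y => by
      rw [show (2 * Real.pi * Complex.I * (pairing y x : ℝ) : ℂ) =
        ((2 * Real.pi * pairing y x : ℝ) : ℂ) * Complex.I by push_cast; ring]
      exact (Complex.norm_exp_ofReal_mul_I _).le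

theorem character_apply (x : ℕ →₀ ℝ) (y : ℕ → ℝ) :
    character x y = Complex.exp (2 * Real.pi * Complex.I * ((pairing y x : ℝ) : ℂ)) := rfl

theorem character_zero_apply (y : ℕ → ℝ) : character 0 y = 1 := by
  simp [character_apply]

theorem norm_character_le (x : ℕ →₀ ℝ) (y : ℕ → ℝ) : ‖character x y‖ ≤ 1 := by
  refine ((character x).norm_coe_le_norm y).trans ?_
  exact BoundedContinuousFunction.norm_ofNormedAddCommGroup_le _ zero_le_one _

/-- A finite measure on `ℝ^∞` is determined by its characteristic function on `ℝ_0^∞`. -/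
theorem ext_of_integral_character {μ ν : Measure (ℕ → ℝ)} [IsFiniteMeasure μ] [IsFiniteMeasure ν]
    (h : ∀ x, ∫ y, character x y ∂μ = ∫ y, character x y ∂ν) : μ = ν := by
  -- With the discrete topology on the dual side, joint continuity of the pairing reduces to
  -- continuity in `y`.
  let _ : TopologicalSpace (ℕ →₀ ℝ) := ⊥
  have : DiscreteTopology (ℕ →₀ ℝ) := ⟨rfl⟩
  have hL : Continuous fun p : (ℕ → ℝ) × (ℕ →₀ ℝ) => pairing p.1 p.2 := by
    rw [continuous_prod_of_discrete_right]
    exact continuous_pairing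
  let _ := TopologicalSpace.upgradeIsCompletelyMetrizable (ℕ → ℝ)
  refine ext_of_integral_char_eq (L := pairing) Real.continuous_fourierChar
    Real.fourierChar_ne_one ?_ hL fun x => ?_
  · intro v hv h0
    refine hv (funext fun k => ?_)
    have := LinearMap.congr_fun h0 (Finsupp.single k 1)
    simpa [pairing_apply] using this
  · convert h x using 3 with y y
    all_goals
      simp only [BoundedContinuousFunction.char_apply, character_apply, Real.fourierChar_apply]
      congr 1
      push_cast
      ring

/-- A set of measures on `ℝ^∞` with tight one-dimensional marginals is tight. -/
theorem isTightMeasureSet_of_map_eval {S : Set (Measure (ℕ → ℝ))}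
    (h : ∀ k, IsTightMeasureSet ((fun μ => μ.map fun y : ℕ → ℝ => y k) '' S)) :
    IsTightMeasureSet S := by
  rw [isTightMeasureSet_iff_exists_isCompact_measure_compl_le]
  intro ε hε
  -- Coordinate `k` may lose mass `δ k`; the total loss outside the compact box stays below `ε`.
  obtain ⟨δ, hδ, hsum⟩ := ENNReal.exists_pos_sum_of_countable' hε.ne' ℕ
  have hK := fun k =>
    isTightMeasureSet_iff_exists_isCompact_measure_compl_le.1 (h k) (δ k) (hδ k)
  choose K hKc hK using hK
  refine ⟨Set.univ.pi K, isCompact_univ_pi hKc, fun μ hμ => ?_⟩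
  have e : (Set.univ.pi K)ᶜ = ⋃ k, (fun y : ℕ → ℝ => y k) ⁻¹' (K k)ᶜ := by
    ext y
    simp
  rw [e]
  refine (measure_iUnion_le _).trans (le_trans (ENNReal.tsum_le_tsum fun k => ?_) hsum.le)
  rw [← Measure.map_apply (measurable_pi_apply k) (hKc k).measurableSet.compl]
  exact hK k _ ⟨μ, hμ, rfl⟩

/-- `charFun` has kernel `e^{ity}` without `2π`, hence the rescaled argument. -/
theorem charFun_map_eval (μ : Measure (ℕ → ℝ)) (k : ℕ) (t : ℝ) :
    charFun (μ.map fun y => y k) t =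
      ∫ y, character (Finsupp.single k (t / (2 * Real.pi))) y ∂μ := by
  rw [charFun_apply_real, integral_map (measurable_pi_apply k).aemeasurable (by fun_prop)]
  refine integral_congr_ae (Eventually.of_forall fun y => ?_)
  have := Real.pi_ne_zero
  simp only [character_apply, pairing_apply]
  rw [Finsupp.sum_single_index (by simp)]
  congr 1
  push_cast
  have : (Real.pi : ℂ) ≠ 0 := by exact_mod_cast this
  field_simp

/-- **Lévy's continuity theorem** on `ℝ^∞`, for probability measures. -/
theorem exists_probabilityMeasure_of_tendsto_character (P : ℕ → ProbabilityMeasure (ℕ → ℝ))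
    {φ : (ℕ →₀ ℝ) → ℂ}
    (hφ : ∀ x, Tendsto (fun n => ∫ y, character x y ∂(P n : Measure (ℕ → ℝ))) atTop (𝓝 (φ x)))
    (hc : ∀ k, ContinuousAt (fun t => φ (Finsupp.single k t)) 0) :
    ∃ μ : ProbabilityMeasure (ℕ → ℝ),
      ∀ x, ∫ y, character x y ∂(μ : Measure (ℕ → ℝ)) = φ x := by
  have tight : IsTightMeasureSet
      {((μ : ProbabilityMeasure (ℕ → ℝ)) : Measure (ℕ → ℝ)) | μ ∈ Set.range P} := by
    refine isTightMeasureSet_of_map_eval fun k => ?_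
    have : ∀ n, IsProbabilityMeasure ((P n : Measure (ℕ → ℝ)).map fun y => y k) := fun n =>
      Measure.isProbabilityMeasure_map (measurable_pi_apply k).aemeasurable
    refine (isTightMeasureSet_of_tendsto_charFun
      (μ := fun n => (P n : Measure (ℕ → ℝ)).map fun y => y k)
      (f := fun t => φ (Finsupp.single k (t / (2 * Real.pi)))) ?_ fun t => ?_).subset ?_
    · have h0 : ContinuousAt (fun t : ℝ => t / (2 * Real.pi)) 0 := by fun_prop
      refine ContinuousAt.comp (g := fun t => φ (Finsupp.single k t)) ?_ h0
      simpa using hc k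
    · simp only [charFun_map_eval]
      exact hφ _
    · rintro _ ⟨_, ⟨_, ⟨n, rfl⟩, rfl⟩, rfl⟩
      exact ⟨n, rfl⟩
  have comp := isCompact_closure_of_isTightMeasureSet tight
  obtain ⟨μ, -, hμ⟩ := comp.exists_mapClusterPt_of_frequently (f := P) (l := atTop)
    (Eventually.of_forall fun n => subset_closure (Set.mem_range_self n)).frequently
  -- Along an ultrafilter finer than `atTop` the cluster point is a genuine weak limit, so no
  -- subsequence is needed.
  obtain ⟨U, hU, hlim⟩ := mapClusterPt_iff_ultrafilter.1 hμ
  refine ⟨μ, fun x => tendsto_nhds_unique ?_ ((hφ x).mono_left hU)⟩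
  exact (ProbabilityMeasure.tendsto_iff_forall_integral_rclike_tendsto ℂ).1 hlim (character x)

theorem norm_integral_character_le (μ : FiniteMeasure (ℕ → ℝ)) (x : ℕ →₀ ℝ) :
    ‖∫ y, character x y ∂(μ : Measure (ℕ → ℝ))‖ ≤ μ.mass := by
  refine (norm_integral_le_of_norm_le_const
    (Eventually.of_forall (norm_character_le x))).trans_eq ?_
  rw [one_mul]
  rfl

/-- **Lévy's continuity theorem** on `ℝ^∞`: a pointwise limit of characteristic functions of
finite measures that is continuous at the origin along every coordinate axis is the
characteristic function of a finite measure. -/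
theorem exists_finiteMeasure_of_tendsto_character (ρ : ℕ → FiniteMeasure (ℕ → ℝ))
    {φ : (ℕ →₀ ℝ) → ℂ}
    (hφ : ∀ x, Tendsto (fun n => ∫ y, character x y ∂(ρ n : Measure (ℕ → ℝ))) atTop (𝓝 (φ x)))
    (hc : ∀ k, ContinuousAt (fun t => φ (Finsupp.single k t)) 0) :
    ∃ μ : Measure (ℕ → ℝ), IsFiniteMeasure μ ∧ ∀ x, ∫ y, character x y ∂μ = φ x := by
  have hmass : Tendsto (fun n => (((ρ n).mass : ℝ) : ℂ)) atTop (𝓝 (φ 0)) := by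
    refine (hφ 0).congr fun n => ?_
    simp only [character_zero_apply, integral_const]
    simp
  have hre : Tendsto (fun n => ((ρ n).mass : ℝ)) atTop (𝓝 (φ 0).re) := by
    exact (Complex.continuous_re.tendsto _).comp hmass
  have h0 : φ 0 = ((φ 0).re : ℂ) :=
    tendsto_nhds_unique hmass ((Complex.continuous_ofReal.tendsto _).comp hre)
  -- If the masses tend to `0`, they dominate the characteristic functions and `φ = 0`. Otherwise
  -- one normalizes and rescales the limit by `φ 0`.
  by_cases hz : (φ 0).re = 0
  · refine ⟨0, inferInstance, fun x => ?_⟩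
    rw [integral_zero_measure]
    refine tendsto_nhds_unique ?_ (hφ x)
    refine squeeze_zero_norm (fun n => norm_integral_character_le (ρ n) x) ?_
    rwa [hz] at hre
  · have hne : φ 0 ≠ 0 := by
      rw [h0]
      exact_mod_cast hz
    have hnn : 0 ≤ (φ 0).re := ge_of_tendsto' hre fun n => NNReal.coe_nonneg _
    have hlim : ∀ x, Tendsto (fun n => ∫ y, character x y ∂((ρ n).normalize : Measure (ℕ → ℝ)))
        atTop (𝓝 ((φ 0)⁻¹ * φ x)) := fun x => by
      refine ((hmass.inv₀ hne).mul (hφ x)).congr' ?_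
      -- Only finitely many masses vanish; there `normalize` is an arbitrary default.
      filter_upwards [hmass.eventually_ne hne] with n hn
      have : ∫ y, character x y ∂(ρ n : Measure (ℕ → ℝ)) =
          (((ρ n).mass : ℝ) : ℂ) * ∫ y, character x y ∂((ρ n).normalize : Measure (ℕ → ℝ)) := by
        conv_lhs => rw [(ρ n).self_eq_mass_smul_normalize]
        rw [FiniteMeasure.toMeasure_smul, integral_smul_nnreal_measure, NNReal.smul_def,
          Complex.real_smul]
        rfl
      rw [this, inv_mul_cancel_left₀ hn]
    obtain ⟨μ, hμ⟩ := exists_probabilityMeasure_of_tendsto_character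
      (fun n => (ρ n).normalize) hlim (fun k => (hc k).const_mul _)
    refine ⟨(φ 0).re.toNNReal • (μ : Measure (ℕ → ℝ)), inferInstance, fun x => ?_⟩
    rw [integral_smul_nnreal_measure, hμ, NNReal.smul_def, Real.coe_toNNReal _ hnn,
      Complex.real_smul, ← h0, mul_inv_cancel_left₀ hne]

end LevyContinuity

/-! ### Translations and the form on `ℒ²(ℝ^∞)` -/

section Translation

theorem translate_add (h : ℕ → ℝ) (f g : L2Seq) :
    translate h (f + g) = translate h f + translate h g :=
  funext fun n => map_add (Lp.compMeasurePreserving _ _) (f n) (g n)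

theorem translate_zero (h : ℕ → ℝ) : translate h 0 = 0 :=
  funext fun _ => map_zero (Lp.compMeasurePreserving _ _)

theorem translate_smul (h : ℕ → ℝ) (c : ℂ) (f : L2Seq) :
    translate h (c • f) = c • translate h f :=
  funext fun n => map_smul (Lp.compMeasurePreservingₗ ℂ _
    (measurePreserving_sub_right volume (proj n h))) c (f n)

theorem translate_coeFn (h : ℕ → ℝ) (f : L2Seq) (n : ℕ) :
    ∀ᵐ x, translate h f n x = f n (x - proj n h) :=
  Lp.coeFn_compMeasurePreserving (f n) (measurePreserving_sub_right volume (proj n h))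

theorem translate_zero_left (f : L2Seq) : translate 0 f = f := by
  refine funext fun n => Lp.ext ?_
  filter_upwards [translate_coeFn 0 f n] with x hx
  rw [hx]
  congr 1
  ext i
  simp [proj]

theorem append_sub_proj {n : ℕ} (h : ℕ → ℝ) (x : EuclideanSpace ℝ (Fin (n + 1))) (t : ℝ) :
    append x t - proj (n + 1) h = append (x - proj n h) (t - h (n + 1)) := by
  ext i
  refine Fin.lastCases ?_ (fun j => ?_) i
  · simp [append, proj]
  · simp [append, proj]

/-- Fubini: carries almost-everywhere identities between representatives to the fibres over which
`compat` integrates. -/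
theorem ae_ae_append {n : ℕ} {p : EuclideanSpace ℝ (Fin (n + 2)) → Prop} (hp : ∀ᵐ x, p x) :
    ∀ᵐ x : EuclideanSpace ℝ (Fin (n + 1)), ∀ᵐ t : ℝ, p (append x t) :=
  Measure.ae_ae_of_ae_prod ((measurePreserving_append n).quasiMeasurePreserving.ae hp)

theorem IsSuperprojective.translate {f : L2Seq} (hf : IsSuperprojective f) (h : ℕ → ℝ) :
    IsSuperprojective (translate h f) where
  nonneg n := by
    filter_upwards [translate_coeFn h f n, (measurePreserving_sub_right volume
      (proj n h)).quasiMeasurePreserving.ae (hf.nonneg n)] with x h1 h2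
    rwa [h1]
  compat n := by
    filter_upwards [translate_coeFn h f n, (measurePreserving_sub_right volume
      (proj n h)).quasiMeasurePreserving.ae (hf.compat n),
      ae_ae_append (translate_coeFn h f (n + 1))] with x h1 h2 h3
    rw [h1]
    refine le_trans (le_of_eq ?_) h2
    rw [← lintegral_sub_right_eq_self
      (fun t => ‖f (n + 1) (append (x - proj n h) t)‖ₑ ^ 2) (h (n + 1))]
    refine lintegral_congr_ae ?_
    filter_upwards [h3] with t ht
    rw [ht, append_sub_proj]

theorem translate_mem {f : L2Seq} (hf : f ∈ SqrtMeasures) (h : ℕ → ℝ) :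
    translate h f ∈ SqrtMeasures := by
  induction hf using Submodule.span_induction with
  | mem f hf => exact Submodule.subset_span (hf.translate h)
  | zero => rw [translate_zero]; exact zero_mem _
  | add f g _ _ hf hg => rw [translate_add]; exact add_mem hf hg
  | smul c f _ hf => rw [translate_smul]; exact Submodule.smul_mem _ c hf

theorem integral_mul_conj_eq_inner (f g : L2Seq) (n : ℕ) :
    ∫ x, f n x * conj (g n x) = inner ℂ (g n) (f n) := by
  simp only [L2.inner_def, RCLike.inner_apply]

/-- `form` is a `limUnder`, so linearity rests on the limits existing, which membership guarantees.
-/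
theorem form_sub_left {f f' g : L2Seq} (hf : f ∈ SqrtMeasures) (hf' : f' ∈ SqrtMeasures)
    (hg : g ∈ SqrtMeasures) : form (f - f') g = form f g - form f' g := by
  refine tendsto_nhds_unique (tendsto_form (sub_mem hf hf') hg)
    (((tendsto_form hf hg).sub (tendsto_form hf' hg)).congr fun n => ?_)
  rw [integral_mul_conj_eq_inner, integral_mul_conj_eq_inner, integral_mul_conj_eq_inner,
    Pi.sub_apply, inner_sub_right]

theorem tendsto_norm_seminorm {f : L2Seq} (hf : f ∈ SqrtMeasures) :
    Tendsto (fun n => ‖f n‖) atTop (𝓝 (seminorm f)) := by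
  refine (((Complex.continuous_re.tendsto _).comp (tendsto_form hf hf)).sqrt).congr fun n => ?_
  rw [Function.comp_apply, integral_mul_conj_eq_inner, inner_self_eq_norm_sq_to_K]
  norm_cast
  exact Real.sqrt_sq (norm_nonneg _)

/-- The Cauchy–Schwarz inequality on `ℒ²(ℝ^∞)`. -/
theorem norm_form_le {f g : L2Seq} (hf : f ∈ SqrtMeasures) (hg : g ∈ SqrtMeasures) :
    ‖form f g‖ ≤ seminorm f * seminorm g := by
  refine le_of_tendsto_of_tendsto' (tendsto_form hf hg).norm
    ((tendsto_norm_seminorm hf).mul (tendsto_norm_seminorm hg)) fun n => ?_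
  rw [integral_mul_conj_eq_inner, mul_comm]
  exact norm_inner_le_norm _ _

/-- On the `k`-th axis the seminorm with weights `a` is just `|a k * t|`, so finite suprema of such
seminorms are continuous in `t`. -/
theorem tendsto_single_directSumTopology (k : ℕ) :
    Tendsto (fun t : ℝ => Finsupp.single k t) (𝓝 0) (@nhds _ directSumTopology 0) := by
  classical
  let _ : TopologicalSpace (ℕ →₀ ℝ) := directSumTopology
  have hw : WithSeminorms weightedSeminorm := ⟨rfl⟩
  rw [hw.tendsto_nhds']
  intro s ε hε
  have hs : Continuous fun t : ℝ => s.sup weightedSeminorm (Finsupp.single k t - 0) := by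
    induction s using Finset.induction_on with
    | empty => exact continuous_const
    | insert a s _ ih =>
      simp only [Finset.sup_insert, Seminorm.sup_apply]
      refine Continuous.sup ?_ ih
      have e : ∀ t : ℝ, weightedSeminorm a (Finsupp.single k t - 0) = |a k * t| := fun t => by
        rw [sub_zero]
        exact Finsupp.sum_single_index (h := fun n t => |a n * t|) (by simp)
      simp only [e]
      fun_prop
  have h0 : s.sup weightedSeminorm (Finsupp.single k 0 - 0) = 0 := by
    rw [Finsupp.single_zero, sub_zero, map_zero]
  exact (hs.tendsto 0).eventually_lt_const (h0.trans_lt hε)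

theorem continuousAt_form_translate_single {f : L2Seq} (hf : f ∈ SqrtMeasures)
    (hcont : IsShiftContinuous f) (k : ℕ) :
    ContinuousAt (fun t : ℝ => form (translate (Finsupp.single k t) f) f) 0 := by
  rw [ContinuousAt, tendsto_iff_norm_sub_tendsto_zero]
  have h := (hcont.comp (tendsto_single_directSumTopology k)).mul_const (seminorm f)
  rw [zero_mul] at h
  refine squeeze_zero (fun _ => norm_nonneg _) (fun t => ?_) h
  rw [Finsupp.single_zero, Finsupp.coe_zero, translate_zero_left,
    ← form_sub_left (translate_mem hf _) hf hf]
  exact norm_form_le (sub_mem (translate_mem hf _) hf) hf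

end Translation

/-! ### The measures `|f̂_n|² dξ` on `ℝ^∞` -/

section SpectralMeasure

/-- The embedding `ℝ^(n+1) → ℝ^∞` that fills up with zeros. -/
def extendZero (n : ℕ) (ξ : EuclideanSpace ℝ (Fin (n + 1))) : ℕ → ℝ := fun k =>
  if h : k < n + 1 then ξ ⟨k, h⟩ else 0

theorem measurable_extendZero (n : ℕ) : Measurable (extendZero n) := by
  refine measurable_pi_lambda _ fun k => ?_
  unfold extendZero
  split_ifs <;> fun_prop

theorem pairing_extendZero (n : ℕ) (ξ : EuclideanSpace ℝ (Fin (n + 1))) (x : ℕ →₀ ℝ) :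
    pairing (extendZero n ξ) x = inner ℝ (proj n x) ξ := by
  have h1 : pairing (extendZero n ξ) x = ∑ k ∈ Finset.range (n + 1), x k * extendZero n ξ k := by
    -- Neither the support of `x` nor `range (n + 1)` need contain the other, so the sum passes
    -- through their union.
    rw [pairing_apply, Finsupp.sum_of_support_subset x (s := x.support ∪ Finset.range (n + 1))
      Finset.subset_union_left _ (by simp)]
    refine (Finset.sum_subset Finset.subset_union_right fun k _ hk => ?_).symm
    rw [Finset.mem_range] at hk
    simp [extendZero, hk]
  rw [h1, Finset.sum_range, PiLp.inner_apply]
  refine Finset.sum_congr rfl fun i _ => ?_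
  simp [extendZero, proj, mul_comm, -not_lt, i.is_lt]

/-- The measure `|F(ξ)|² dξ`, for an `L²`-function `F` on `ℝ^(n+1)`, carried over to `ℝ^∞`. -/
def spectralMeasure {n : ℕ} (F : Lp ℂ 2 (volume : Measure (EuclideanSpace ℝ (Fin (n + 1))))) :
    Measure (ℕ → ℝ) :=
  (volume.withDensity fun ξ => ((‖F ξ‖₊ ^ 2 : NNReal) : ENNReal)).map (extendZero n)

instance {n : ℕ} (F : Lp ℂ 2 (volume : Measure (EuclideanSpace ℝ (Fin (n + 1))))) :
    IsFiniteMeasure (spectralMeasure F) := by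
  have : IsFiniteMeasure (volume.withDensity fun ξ => ((‖F ξ‖₊ ^ 2 : NNReal) : ENNReal)) := by
    refine isFiniteMeasure_withDensity ?_
    have := ((memLp_two_iff_integrable_sq_norm (Lp.memLp F).1).1 (Lp.memLp F)).2
    simpa [HasFiniteIntegral, enorm_pow, enorm_eq_nnnorm] using this.ne
  unfold spectralMeasure
  infer_instance

theorem integral_character_spectralMeasure {n : ℕ}
    (F : Lp ℂ 2 (volume : Measure (EuclideanSpace ℝ (Fin (n + 1))))) (x : ℕ →₀ ℝ) :
    ∫ y, character x y ∂(spectralMeasure F) =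
      ∫ ξ, modulation (proj n x) ξ * ((‖F ξ‖ ^ 2 : ℝ) : ℂ) := by
  rw [spectralMeasure, integral_map (measurable_extendZero n).aemeasurable
    (character x).continuous.aestronglyMeasurable,
    integral_withDensity_eq_integral_smul
      ((Lp.stronglyMeasurable F).measurable.nnnorm.pow_const 2)]
  refine integral_congr_ae (Eventually.of_forall fun ξ => ?_)
  simp only [character_apply, pairing_extendZero, modulation, NNReal.smul_def, Complex.real_smul]
  rw [mul_comm]
  simp

theorem tendsto_integral_character_spectralMeasure {f : L2Seq} (hf : f ∈ SqrtMeasures)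
    (x : ℕ →₀ ℝ) :
    Tendsto (fun n => ∫ y, character x y ∂(spectralMeasure (fourier f n))) atTop
      (𝓝 (form (translate x f) f)) := by
  refine (tendsto_form (translate_mem hf x) hf).congr fun n => ?_
  rw [integral_character_spectralMeasure]
  exact (integral_modulation_mul_norm_sq_fourierInv (f n) (proj n x)).symm

end SpectralMeasure

end SqrtMeasure

end

theorem proposition3p5 (f : SqrtMeasure.L2Seq) (hf : f ∈ SqrtMeasure.SqrtMeasures)
    (hcont : SqrtMeasure.IsShiftContinuous f) :
    ∃! μ : Measure (ℕ → ℝ), IsFiniteMeasure μ ∧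
      ∀ x : ℕ →₀ ℝ,
        Tendsto
          (fun n => ∫ ξ : EuclideanSpace ℝ (Fin (n + 1)),
            Complex.exp (2 * Real.pi * Complex.I * (inner ℝ (SqrtMeasure.proj n x) ξ : ℝ)) *
              ((‖SqrtMeasure.fourier f n ξ‖ ^ 2 : ℝ) : ℂ))
          atTop
          (𝓝 (∫ y : ℕ → ℝ,
            Complex.exp (2 * Real.pi * Complex.I * ((x.sum fun k t => t * y k : ℝ) : ℂ)) ∂μ)) := by
  have lim := fun x : ℕ →₀ ℝ => SqrtMeasure.tendsto_integral_character_spectralMeasure hf x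
  obtain ⟨μ, hfin, hμ⟩ := SqrtMeasure.exists_finiteMeasure_of_tendsto_character
    (fun n => ⟨SqrtMeasure.spectralMeasure (SqrtMeasure.fourier f n), inferInstance⟩) lim
    (SqrtMeasure.continuousAt_form_translate_single hf hcont)
  -- From integrals over `ℝ^∞` back to the Lebesgue integrals of the statement.
  simp only [SqrtMeasure.integral_character_spectralMeasure] at lim
  refine ⟨μ, ⟨hfin, fun x => ?_⟩, fun ν hν => ?_⟩
  · have h := lim x
    rw [← hμ] at h
    exact h
  · have := hν.1
    refine SqrtMeasure.ext_of_integral_character fun x => ?_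
    rw [hμ]
    exact tendsto_nhds_unique (hν.2 x) (lim x)
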